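/- Let $\Bbbk$ be a field, $Q$ a commutative Noetherian monoid (written additively), $P\subset Q$ a prime ideal ($P=\varnothing$ allowed), and write $t^a$ for the monomials of $\Bbbk[Q]$. A binomial is an element $t^a-\lambda t^b$ with $a,b\in Q$, $\lambda\in\Bbbk$ ($\lambda=0$ allowed); a binomial ideal is one generated by binomials. A binomial ideal $I$ induces the congruence $\sim_I$ on $Q$ with $a\sim_I b$ iff $t^a-\lambda t^b\in I$ for some $\lambda\neq0$. For a congruence $\sim$ on $Q$ write $\overline q$ for the class of $q$ in $\overline Q=Q/{\sim}$, and $\overline Q_P$ for the localization of $\overline Q$ inverting the classes of all elements outside $P$. A class $\overline n$ is nil if $\overline n+\overline q=\overline n$ for all $q$. An element $q$ is a key aide for $w$ if for every $p\in P$: $\overline q\ne\overline w$, $\overline w+\overline p=\overline q+\overline p$, and $\overline w$ is not strictly above $\overline q$ in Green's preorder (that is, if $\overline w\in\langle\overline q\rangle$ then $\overline q\in\langle\overline w\rangle$). A key witness is an element having a key aide; a key witness pair consists of two key witnesses, distinct modulo $\sim$, each of which is a key aide for the other; a cogenerator is a key witness $w$ such that $\overline w+\overline p$ is nil for all $p\in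 P$. The congruence is $P$-coprincipal if every $p\in P$ is nilpotent in $\overline Q$ (some multiple of it is nil), every $f\in Q\setminus P$ is cancellative in $\overline Q$, for all $q$ and all $a,b$ cancellative in $\overline Q$ with $\overline q+\overline a=\overline q+\overline b$ not nil one has $\overline a=\overline b$, and all cogenerators generate the same ideal of $\overline Q_P$. A binomial ideal $I\subsetneq\Bbbk[Q]$ is $P$-coprincipal if $\sim_I$ is $P$-coprincipal and $I$ is maximal among the proper binomial ideals inducing $\sim_I$; it is cogenerated by $w$ if moreover $w$ is a cogenerator of $\sim_I$. Let $I$ be a $P$-coprincipal binomial ideal cogenerated by $w\in Q$, let $\overline Q=Q/{\sim_I}$, and let $I_1$ be its (first) binoccular collapse, the ideal generated by $I$ together with all binomials $t^a-\lambda t^b$ such that $t^p(t^a-\lambda t^b)\in I$ for all $p\in P$ and such that neither $a$ nor $b$ maps into the ideal of $\overline Q_P$ generated by the image of $w$. Then $I_1$ is again a $P$-coprincipal binomial ideal cogenerated by $w$. Moreover, for every binomial $t^a-\lambda t^b\in I_1\setminus I$, the elements $a$ and $b$ form a key witness pair for $\sim_I$. -/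

import Mathlib

namespace Binoccular

open AddMonoidAlgebra

section Monoids

variable {Q : Type*} [AddCommMonoid Q]

/-- A prime ideal `P` of the commutative monoid `Q`: a subset absorbing addition whose complement
is a submonoid. The empty set is allowed, the whole monoid is not. -/
structure IsMonoidPrime (P : Set Q) : Prop where
  add_mem : ∀ p ∈ P, ∀ q : Q, p + q ∈ P
  zero_notMem : (0 : Q) ∉ P
  mem_or_mem : ∀ a b : Q, a + b ∈ P → a ∈ P ∨ b ∈ P

/-- `n` is nil modulo `r`: its class is an absorbing element of `Q / r`. -/
def IsNil (r : AddCon Q) (n : Q) : Prop := ∀ q : Q, r (n + q) n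

/-- `p` is nilpotent modulo `r`: some multiple of it is nil. -/
def IsNilpotentMod (r : AddCon Q) (p : Q) : Prop := ∃ m : ℕ, IsNil r (m • p)

/-- `f` is cancellative modulo `r`. -/
def IsCancellative (r : AddCon Q) (f : Q) : Prop := ∀ a b : Q, r (a + f) (b + f) → r a b

/-- `q` is partly cancellative modulo `r`. -/
def IsPartlyCancellative (r : AddCon Q) (q : Q) : Prop :=
  ∀ a b : Q, IsCancellative r a → IsCancellative r b →
    r (q + a) (q + b) → ¬ IsNil r (q + a) → r a b

/-- Green's preorder on `Q / r`: the class of `b` lies in the ideal generated by the class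
of `a`. The nil class, if there is one, is the largest. -/
def GreenLE (r : AddCon Q) (a b : Q) : Prop := ∃ c : Q, r b (a + c)

/-- Green's preorder on the localization of `Q / r` at `P`: the image of `b` lies in the ideal
generated by the image of `a` once all elements outside of `P` have been inverted. -/
def LocGreenLE (P : Set Q) (r : AddCon Q) (a b : Q) : Prop :=
  ∃ f : Q, f ∉ P ∧ GreenLE r a (b + f)

/-- `q` is an aide for `w` and `p`: the classes of `w` and `q` are distinct, they become equal
after adding `p`, and the class of `q` is maximal among the two (that is, the class of `w` is not
strictly above it in Green's preorder). -/
def IsAide (r : AddCon Q) (q w p : Q) : Prop :=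
  ¬ r w q ∧ r (w + p) (q + p) ∧ (GreenLE r q w → GreenLE r w q)

/-- `q` is a key aide for `w`: the same `q` is an aide for `w` and every `p ∈ P`. -/
def IsKeyAide (P : Set Q) (r : AddCon Q) (q w : Q) : Prop := ∀ p ∈ P, IsAide r q w p

/-- Key witnesses for `P`. -/
def IsKeyWitness (P : Set Q) (r : AddCon Q) (w : Q) : Prop := ∃ q : Q, IsKeyAide P r q w

/-- Cogenerators: key witnesses that every element of `P` moves into the nil class. -/
def IsCogenerator (P : Set Q) (r : AddCon Q) (w : Q) : Prop :=
  IsKeyWitness P r w ∧ ∀ p ∈ P, IsNil r (w + p)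

/-- Key witness pairs: two key witnesses, distinct modulo `r`, each a key aide for the other. -/
def IsKeyWitnessPair (P : Set Q) (r : AddCon Q) (a b : Q) : Prop :=
  ¬ r a b ∧ IsKeyWitness P r a ∧ IsKeyWitness P r b ∧ IsKeyAide P r a b ∧ IsKeyAide P r b a

/-- `P`-primary congruences. -/
def IsPrimaryCon (P : Set Q) (r : AddCon Q) : Prop :=
  (∀ p ∈ P, IsNilpotentMod r p) ∧ ∀ f, f ∉ P → IsCancellative r f

/-- `P`-mesoprimary congruences. -/
def IsMesoprimaryCon (P : Set Q) (r : AddCon Q) : Prop :=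
  IsPrimaryCon P r ∧ ∀ q : Q, IsPartlyCancellative r q

/-- `P`-coprincipal congruences: `P`-mesoprimary, and all cogenerators generate the same ideal
of the localized quotient. -/
def IsCoprincipalCon (P : Set Q) (r : AddCon Q) : Prop :=
  IsMesoprimaryCon P r ∧
    ∀ v w : Q, IsCogenerator P r v → IsCogenerator P r w → LocGreenLE P r v w

end Monoids

section Ideals

variable {k : Type*} [Field k] {Q : Type*} [AddCommMonoid Q]

/-- The monomial `t ^ a` of the monoid algebra `k[Q]`. -/
noncomputable def mono (k : Type*) [Field k] {Q : Type*} (a : Q) : AddMonoidAlgebra k Q :=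
  single a 1

/-- The binomial `t ^ a - c t ^ b`; the coefficient `c` may be zero. -/
noncomputable def binom (a b : Q) (c : k) : AddMonoidAlgebra k Q := mono k a - c • mono k b

theorem mono_add (a b : Q) : mono k (a + b) = mono k a * mono k b := by
  simp [mono, single_mul_single]

/-- Binomial ideals: those generated by binomials. -/
def IsBinomialIdeal (I : Ideal (AddMonoidAlgebra k Q)) : Prop :=
  ∃ S : Set (AddMonoidAlgebra k Q), (∀ g ∈ S, ∃ (a b : Q) (c : k), g = binom a b c) ∧
    I = Ideal.span S

/-- The congruence induced by `I`: it relates `a` and `b` when `t ^ a - c t ^ b ∈ I` for some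
nonzero scalar `c`. -/
def inducedCon (I : Ideal (AddMonoidAlgebra k Q)) : AddCon Q where
  r a b := ∃ c : k, c ≠ 0 ∧ binom a b c ∈ I
  iseqv :=
    { refl := fun a => ⟨1, one_ne_zero, by simp [binom]⟩
      symm := by
        rintro a b ⟨c, hc, h⟩
        refine ⟨c⁻¹, inv_ne_zero hc, ?_⟩
        have h2 := Submodule.smul_of_tower_mem I (-c⁻¹) h
        have e : (-c⁻¹) • binom a b c = binom b a c⁻¹ := by
          simp only [binom, smul_sub, smul_smul, neg_smul, neg_mul, inv_mul_cancel₀ hc, one_smul]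
          abel
        rwa [e] at h2
      trans := by
        rintro a b d ⟨c, hc, h⟩ ⟨c', hc', h'⟩
        refine ⟨c * c', mul_ne_zero hc hc', ?_⟩
        have h2 := I.add_mem h (Submodule.smul_of_tower_mem I c h')
        have e : binom a b c + c • binom b d c' = binom a d (c * c') := by
          simp only [binom, smul_sub, smul_smul]
          abel
        rwa [e] at h2 }
  add' := by
    rintro a b a' b' ⟨c, hc, h⟩ ⟨c', hc', h'⟩
    refine ⟨c * c', mul_ne_zero hc hc', ?_⟩
    have h2 := I.add_mem (I.mul_mem_left (mono k a') h)
      (Submodule.smul_of_tower_mem I c (I.mul_mem_left (mono k b) h'))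
    have e : mono k a' * binom a b c + c • (mono k b * binom a' b' c')
        = binom (a + a') (b + b') (c * c') := by
      simp only [binom, mono_add, mul_sub, smul_sub, mul_smul_comm, smul_smul]
      rw [mul_comm (mono k a') (mono k a), mul_comm (mono k a') (mono k b)]
      abel
    rwa [e] at h2

/-- `P`-coprincipal binomial ideals: proper binomial ideals whose induced congruence is
`P`-coprincipal and that are maximal among the (proper) binomial ideals inducing it. Properness
matters only for the congruence with a single class, the only one that the unit ideal induces. -/
structure IsCoprincipalIdeal (P : Set Q) (I : Ideal (AddMonoidAlgebra k Q)) : Prop where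
  binomial : IsBinomialIdeal I
  ne_top : I ≠ ⊤
  con : IsCoprincipalCon P (inducedCon I)
  maximal : ∀ J : Ideal (AddMonoidAlgebra k Q), IsBinomialIdeal J → J ≠ ⊤ → I ≤ J →
    inducedCon J = inducedCon I → J = I

/-- The first binoccular collapse of the `P`-coprincipal ideal `I` cogenerated by `w`: add to `I`
all binomials `t ^ a - c t ^ b` that are annihilated modulo `I` by every `t ^ p` with `p ∈ P` and
for which neither `a` nor `b` lies in the ideal generated by `w` in the localized quotient
of `Q`. -/
noncomputable def collapse (P : Set Q) (I : Ideal (AddMonoidAlgebra k Q)) (w : Q) :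
    Ideal (AddMonoidAlgebra k Q) :=
  I ⊔ Ideal.span {g | ∃ (a b : Q) (c : k), g = binom a b c ∧
    ¬ LocGreenLE P (inducedCon I) w a ∧ ¬ LocGreenLE P (inducedCon I) w b ∧
    ∀ p ∈ P, mono k p * g ∈ I}

end Ideals

end Binoccular

namespace Binoccular

open AddMonoidAlgebra

/-! ### Binomials in an ideal, and tests for membership by linear functionals -/

section Binomials

variable {k : Type*} [Field k] {Q : Type*} [AddCommMonoid Q]

/-! The crux is `binom_mem_collapse`: a binomial of the collapse either lies in `I` or is itself one
of the added generators, with nonzero coefficient. These two kinds form a scalar-weighted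
equivalence relation stable under translation, and `binom_mem_span_cases` shows, by weight
functionals supported on single classes, that the span contains no further binomials beyond those
with nil exponents. Hence the new congruence is coarser only outside the localized ideal of `w`. The
nil class lies inside that ideal, so it does not change, and coprincipality transfers. Outside that
ideal some `p ∈ P` keeps an element non-nil (`IsCoprincipalCon.exists_not_isNil_add`), and
translating by it reduces partial cancellation and the key aide property to the old congruence.
Maximality of `I` puts all nil monomials into it (`IsCoprincipalIdeal.mono_mem`); since the nil
class is unchanged, this gives maximality of the collapse. -/

theorem binom_zero_right (a b : Q) : binom a b (0 : k) = mono k a := by simp [binom]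

theorem mono_mul_binom (q a b : Q) (c : k) :
    mono k q * binom a b c = binom (q + a) (q + b) c := by
  simp only [binom, mono_add, mul_sub, mul_smul_comm]

theorem binom_self_one_mem (J : Ideal (AddMonoidAlgebra k Q)) (a : Q) :
    binom a a (1 : k) ∈ J := by simp [binom]

theorem binom_inv_mem {J : Ideal (AddMonoidAlgebra k Q)} {a b : Q} {c : k} (hc : c ≠ 0)
    (h : binom a b c ∈ J) : binom b a c⁻¹ ∈ J := by
  have h2 := Submodule.smul_of_tower_mem J (-c⁻¹) h
  have e : (-c⁻¹) • binom a b c = binom b a c⁻¹ := by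
    simp only [binom, smul_sub, smul_smul, neg_smul, neg_mul, inv_mul_cancel₀ hc, one_smul]
    abel
  rwa [e] at h2

theorem binom_mul_mem {J : Ideal (AddMonoidAlgebra k Q)} {a b d : Q} {c c' : k}
    (h : binom a b c ∈ J) (h' : binom b d c' ∈ J) : binom a d (c * c') ∈ J := by
  have h2 := J.add_mem h (Submodule.smul_of_tower_mem J c h')
  have e : binom a b c + c • binom b d c' = binom a d (c * c') := by
    simp only [binom, smul_sub, smul_smul]
    abel
  rwa [e] at h2

theorem binom_mem_of_mono_mem {J : Ideal (AddMonoidAlgebra k Q)} {a b : Q} (c : k)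
    (ha : mono k a ∈ J) (hb : mono k b ∈ J) : binom a b c ∈ J :=
  J.sub_mem ha (Submodule.smul_of_tower_mem J c hb)

/-- Two binomials with the same monomials and different coefficients force the monomials in. -/
theorem mono_mem_of_binom_mem {J : Ideal (AddMonoidAlgebra k Q)} {a b : Q} {c c' : k}
    (h : binom a b c ∈ J) (h' : binom a b c' ∈ J) (hc : c ≠ c') :
    mono k a ∈ J ∧ mono k b ∈ J := by
  have hb : mono k b ∈ J := by
    have h2 := Submodule.smul_of_tower_mem J (c' - c)⁻¹ (J.sub_mem h h')
    have e : (c' - c)⁻¹ • (binom a b c - binom a b c') = mono k b := by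
      have : binom a b c - binom a b c' = (c' - c) • mono k b := by
        simp only [binom, sub_smul]; abel
      rw [this, smul_smul, inv_mul_cancel₀ (sub_ne_zero.2 hc.symm), one_smul]
    rwa [e] at h2
  refine ⟨?_, hb⟩
  have h2 := J.add_mem h (Submodule.smul_of_tower_mem J c hb)
  have e : binom a b c + c • mono k b = mono k a := by simp [binom]
  rwa [e] at h2

theorem isNil_of_mono_mem {J : Ideal (AddMonoidAlgebra k Q)} {a : Q} (h : mono k a ∈ J) :
    IsNil (inducedCon J) a := fun q =>
  ⟨1, one_ne_zero, binom_mem_of_mono_mem 1 (by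
    rw [add_comm, mono_add]; exact J.mul_mem_left _ h) h⟩

theorem eq_top_of_mono_zero_mem {J : Ideal (AddMonoidAlgebra k Q)} (h : mono k (0 : Q) ∈ J) :
    J = ⊤ := (Ideal.eq_top_iff_one J).2 h

theorem map_eq_zero_of_mem_span (φ : AddMonoidAlgebra k Q →ₗ[k] k)
    {T : Set (AddMonoidAlgebra k Q)} (hT : ∀ g ∈ T, ∀ q : Q, φ (mono k q * g) = 0)
    {x : AddMonoidAlgebra k Q} (hx : x ∈ Ideal.span T) : φ x = 0 := by
  -- `φ` is only `k`-linear, so the induction needs a statement closed under multiplication.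
  suffices H : ∀ y : AddMonoidAlgebra k Q, φ (y * x) = 0 by simpa using H 1
  refine Submodule.span_induction (p := fun x _ => ∀ y, φ (y * x) = 0) ?_ ?_ ?_ ?_ hx
  · intro g hg y
    induction y using AddMonoidAlgebra.induction_linear with
    | zero => simp
    | add f g hf hg => rw [add_mul, map_add, hf, hg, add_zero]
    | single q r =>
      have e : single q r = r • mono k q := by
        simp [mono]
      rw [e, smul_mul_assoc, map_smul, hT g hg q, smul_zero]
  · intro y; simp
  · intro x y _ _ hx hy z; rw [mul_add, map_add, hx, hy, add_zero]
  · intro a x _ hx y; rw [smul_eq_mul, ← mul_assoc]; exact hx _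

/-- Extended linearly to the algebra, the weight kills every translate of every generator. -/
theorem weight_eq_of_binom_mem_span (φ : Q → k) {T : Set (AddMonoidAlgebra k Q)}
    (hT : ∀ g ∈ T, ∃ (a b : Q) (c : k), g = binom a b c ∧ ∀ q, φ (q + a) = c * φ (q + b))
    {a b : Q} {c : k} (h : binom a b c ∈ Ideal.span T) : φ a = c * φ b := by
  obtain ⟨Φ, hΦ⟩ : ∃ Φ : AddMonoidAlgebra k Q →ₗ[k] k, ∀ q, Φ (mono k q) = φ q :=
    ⟨(Finsupp.linearCombination k φ).comp (coeffLinearEquiv k).toLinearMap, fun q => by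
      simp [mono]⟩
  have hb : ∀ (a b : Q) (c : k), Φ (binom a b c) = φ a - c * φ b := fun a b c => by
    simp [binom, hΦ]
  have := map_eq_zero_of_mem_span Φ (fun g hg q => by
    obtain ⟨a, b, c, rfl, h⟩ := hT g hg
    rw [mono_mul_binom, hb, h q, sub_self]) h
  rw [hb] at this
  exact sub_eq_zero.1 this

/-- Binomials of an ideal generated by binomials, described by a twisted equivalence relation `R`
away from a set `Z` of exponents whose monomials may lie in the ideal. -/
theorem binom_mem_span_cases (R : Q → Q → k → Prop) (Z : Set Q) (refl : ∀ a, R a a 1)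
    (symm : ∀ a b c, R a b c → R b a c⁻¹)
    (trans : ∀ a b d c c', R a b c → R b d c' → R a d (c * c'))
    (uniq : ∀ a c, a ∉ Z → R a a c → c = 1) (ne : ∀ a b c, R a b c → c ≠ 0)
    (sat : ∀ a b c, R a b c → a ∈ Z → b ∈ Z) {T : Set (AddMonoidAlgebra k Q)}
    (hT : ∀ g ∈ T, ∃ (a b : Q) (c : k), g = binom a b c ∧
      ∀ q, (q + a ∈ Z ∧ (c = 0 ∨ q + b ∈ Z)) ∨ R (q + a) (q + b) c)
    {a b : Q} {c : k} (h : binom a b c ∈ Ideal.span T) :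
    (a ∈ Z ∧ (c = 0 ∨ b ∈ Z)) ∨ R a b c := by
  classical
  have key : ∀ x, x ∉ Z → ∃ φ : Q → k, (∀ y d, R y x d → φ y = d) ∧
      (∀ y, φ y ≠ 0 → R y x (φ y)) ∧ φ a = c * φ b := by
    intro x hx
    -- The weight of `y` is its scalar relative to the base point `x`, unique by `uniq`, and 0 off
    -- the class of `x`.
    set φ : Q → k := fun y => if h : ∃ d, R y x d then h.choose else 0 with hφ
    have hval : ∀ y d, R y x d → φ y = d := by
      intro y d hd
      have hex : ∃ d, R y x d := ⟨d, hd⟩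
      have h1 : R y x (φ y) := by simpa only [hφ, dif_pos hex] using hex.choose_spec
      have h2 := uniq x _ hx (trans _ _ _ _ _ (symm _ _ _ hd) h1)
      rw [inv_mul_eq_one₀ (ne _ _ _ hd)] at h2
      exact h2.symm
    have hspec : ∀ y, φ y ≠ 0 → R y x (φ y) := by
      intro y hy
      by_cases hex : ∃ d, R y x d
      · rw [hval y _ hex.choose_spec]; exact hex.choose_spec
      · exact absurd (by simp only [hφ, dif_neg hex]) hy
    have hZ : ∀ y ∈ Z, φ y = 0 := fun y hy => by
      by_contra h0
      exact hx (sat _ _ _ (hspec y h0) hy)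
    refine ⟨φ, hval, hspec, weight_eq_of_binom_mem_span φ (fun g hg => ?_) h⟩
    obtain ⟨a, b, c, rfl, h⟩ := hT g hg
    refine ⟨a, b, c, rfl, fun q => ?_⟩
    rcases h q with ⟨h1, h2⟩ | h1
    · rw [hZ _ h1]
      rcases h2 with h2 | h2
      · rw [h2, zero_mul]
      · rw [hZ _ h2, mul_zero]
    · by_cases h0 : φ (q + b) = 0
      · rw [h0, mul_zero]
        by_contra h3
        have h4 := trans _ _ _ _ _ (symm _ _ _ h1) (hspec _ h3)
        exact ne _ _ _ h4 ((hval _ _ h4).symm.trans h0)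
      · exact hval _ _ (trans _ _ _ _ _ h1 (hspec _ h0))
  -- The base point must avoid `Z`: it is `b` when `a ∈ Z`, and `a` otherwise.
  by_cases ha : a ∈ Z
  · by_cases hc : c = 0
    · exact Or.inl ⟨ha, Or.inl hc⟩
    by_cases hb : b ∈ Z
    · exact Or.inl ⟨ha, Or.inr hb⟩
    obtain ⟨φ, h1, h2, h3⟩ := key b hb
    rw [h1 b 1 (refl b), mul_one] at h3
    exact Or.inr (h3 ▸ h2 a (h3 ▸ hc))
  · obtain ⟨φ, h1, h2, h3⟩ := key a ha
    rw [h1 a 1 (refl a)] at h3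
    have hb : φ b ≠ 0 := fun h0 => by simp [h0] at h3
    have h4 := symm _ _ _ (h2 b hb)
    rw [← eq_inv_of_mul_eq_one_left h3.symm] at h4
    exact Or.inr h4

end Binomials

/-! ### Nil classes, cogenerators and key aides -/

section Nil

variable {Q : Type*} [AddCommMonoid Q] {P : Set Q} {r : AddCon Q}

theorem IsNil.of_rel {a b : Q} (h : IsNil r a) (hab : r a b) : IsNil r b := fun q =>
  r.trans (r.add (r.symm hab) (r.refl q)) (r.trans (h q) hab)

theorem IsNil.rel {a b : Q} (ha : IsNil r a) (hb : IsNil r b) : r a b :=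
  r.trans (r.symm (ha b)) (by rw [add_comm]; exact hb a)

theorem IsNil.add {a : Q} (ha : IsNil r a) (q : Q) : IsNil r (a + q) :=
  ha.of_rel (r.symm (ha q))

theorem IsNil.add_left {a : Q} (ha : IsNil r a) (q : Q) : IsNil r (q + a) :=
  add_comm a q ▸ ha.add q

theorem IsCancellative.isNil {f a : Q} (hf : IsCancellative r f) (h : IsNil r (a + f)) :
    IsNil r a := fun q => hf _ _ (by
  rw [add_right_comm]; exact h q)

/-- The nil element `n` serves as key aide: only nil elements lie above it, so the order condition
is vacuous. -/
theorem isCogenerator_of_not_isNil {n v : Q} (hn : IsNil r n) (hv : ¬ IsNil r v)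
    (h : ∀ p ∈ P, IsNil r (v + p)) : IsCogenerator P r v := by
  refine ⟨⟨n, fun p hp => ⟨fun h1 => hv (hn.of_rel (r.symm h1)), (h p hp).rel (hn.add p), ?_⟩⟩, h⟩
  rintro ⟨c, hc⟩
  exact absurd ((hn.add c).of_rel (r.symm hc)) hv

/-- A nil `v` lies above its aide, so the order condition would make the aide nil and equal to `v`.
The element `p` is needed because key aides are vacuous for empty `P`. -/
theorem IsCogenerator.not_isNil {p v : Q} (hp : p ∈ P) (hv : IsCogenerator P r v) :
    ¬ IsNil r v := by
  intro hn
  obtain ⟨⟨q, hq⟩, -⟩ := hv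
  obtain ⟨h1, -, h3⟩ := hq p hp
  obtain ⟨c, hc⟩ := h3 ⟨v, r.symm (by rw [add_comm]; exact hn q)⟩
  exact h1 (r.symm (r.trans hc (hn c)))

theorem IsMonoidPrime.add_notMem (hP : IsMonoidPrime P) {f g : Q} (hf : f ∉ P) (hg : g ∉ P) :
    f + g ∉ P := fun h => (hP.mem_or_mem f g h).elim hf hg

theorem LocGreenLE.of_rel {w a b : Q} (hab : r a b) (h : LocGreenLE P r w a) :
    LocGreenLE P r w b := by
  obtain ⟨f, hf, c, hc⟩ := h
  exact ⟨f, hf, c, r.trans (r.add (r.symm hab) (r.refl f)) hc⟩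

theorem LocGreenLE.add_right {w a : Q} (h : LocGreenLE P r w a) (q : Q) :
    LocGreenLE P r w (a + q) := by
  obtain ⟨f, hf, c, hc⟩ := h
  refine ⟨f, hf, c + q, ?_⟩
  rw [add_right_comm, ← add_assoc]
  exact r.add hc (r.refl q)

theorem LocGreenLE.of_add (hP : IsMonoidPrime P) {w a g : Q} (hg : g ∉ P)
    (h : LocGreenLE P r w (a + g)) : LocGreenLE P r w a := by
  obtain ⟨f, hf, c, hc⟩ := h
  exact ⟨g + f, hP.add_notMem hg hf, c, by rwa [← add_assoc]⟩

theorem IsNil.locGreenLE (hP : IsMonoidPrime P) {n : Q} (hn : IsNil r n) (w : Q) :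
    LocGreenLE P r w n :=
  ⟨0, hP.zero_notMem, n, by rw [add_zero, add_comm]; exact r.symm (hn w)⟩

/-- An element outside of the localized ideal of a cogenerator is not moved into the nil class by
all of `P`. -/
theorem IsCoprincipalCon.exists_not_isNil_add (hP : IsMonoidPrime P) (hr : IsCoprincipalCon P r)
    {n w a : Q} (hn : IsNil r n) (hw : IsCogenerator P r w) (ha : ¬ LocGreenLE P r w a) :
    ∃ p ∈ P, ¬ IsNil r (a + p) := by
  by_contra! h
  exact ha (hr.2 w a hw (isCogenerator_of_not_isNil hn
    (fun h0 => ha (h0.locGreenLE hP w)) h))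

theorem IsNilpotentMod.isNil_of_rel_add {p a : Q} (hp : IsNilpotentMod r p)
    (h : r a (a + p)) : IsNil r a := by
  obtain ⟨m, hm⟩ := hp
  have H : ∀ j : ℕ, r a (a + j • p) := by
    intro j
    induction j with
    | zero => simpa using r.refl a
    | succ j ih =>
      rw [succ_nsmul', ← add_assoc]
      exact r.trans ih (r.add h (r.refl _))
  exact (hm.add_left a).of_rel (r.symm (H m))

/-- The key aide property for elements outside of the localized ideal of a cogenerator. -/
theorem IsCoprincipalCon.isKeyAide (hP : IsMonoidPrime P) (hr : IsCoprincipalCon P r)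
    {n w a b : Q} (hn : IsNil r n) (hw : IsCogenerator P r w) (ha : ¬ LocGreenLE P r w a)
    (hb : ¬ LocGreenLE P r w b) (hab : ¬ r a b) (h : ∀ p ∈ P, r (a + p) (b + p)) :
    IsKeyAide P r b a := by
  refine fun p hp => ⟨hab, h p hp, ?_⟩
  rintro ⟨c, hc⟩
  exfalso
  -- Here `a` is `b + c` modulo `r`. If `c ∈ P`, then `a + c` is again `a`, so `a` is nil; otherwise
  -- partial cancellation at a non-nil `b + p` makes `c` trivial.
  by_cases hcP : c ∈ P
  · exact ha ((((hr.1.1.1 c hcP).isNil_of_rel_add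
      (r.trans hc (r.symm (h c hcP)))).locGreenLE hP w))
  · obtain ⟨p, hp, hnil⟩ := hr.exists_not_isNil_add hP hn hw hb
    refine hab (r.trans hc ?_)
    have h1 : r c 0 := by
      have h2 : r (b + p + c) (b + p + 0) := by
        rw [add_zero, add_right_comm]
        exact r.trans (r.add (r.symm hc) (r.refl p)) (h p hp)
      exact hr.1.2 (b + p) c 0 (hr.1.1.2 c hcP) (hr.1.1.2 0 hP.zero_notMem) h2
        fun h3 => hnil (by simpa using h3.of_rel h2)
    simpa using r.add (r.refl b) h1

end Nil

/-! ### Nil monomials and the binomials of the collapse -/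

section Ideals

variable {k : Type*} [Field k] {Q : Type*} [AddCommMonoid Q] {P : Set Q}
  {I : Ideal (AddMonoidAlgebra k Q)} {w : Q}

/-- The elements that every `t ^ p` with `p ∈ P` moves into `I`. -/
def annihilated (P : Set Q) (I : Ideal (AddMonoidAlgebra k Q)) :
    Ideal (AddMonoidAlgebra k Q) where
  carrier := {g | ∀ p ∈ P, mono k p * g ∈ I}
  add_mem' hf hg p hp := by rw [mul_add]; exact I.add_mem (hf p hp) (hg p hp)
  zero_mem' p _ := by rw [mul_zero]; exact I.zero_mem
  smul_mem' c g hg p hp := by rw [smul_eq_mul, mul_left_comm]; exact I.mul_mem_left c (hg p hp)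

theorem le_annihilated : I ≤ annihilated P I := fun _ hg _ _ => I.mul_mem_left _ hg

/-- Maximality of a binomial ideal puts the nil monomials into it. -/
theorem IsCoprincipalIdeal.mono_mem (hI : IsCoprincipalIdeal P I)
    (h0 : ¬ IsNil (inducedCon I) 0) {n : Q} (hn : IsNil (inducedCon I) n) : mono k n ∈ I := by
  obtain ⟨T, hT, hIT⟩ := hI.binomial
  have hle : I ≤ Ideal.span (T ∪ {mono k n}) := by
    conv_lhs => rw [hIT]
    exact Ideal.span_mono Set.subset_union_left
  have hTI : ∀ g ∈ T, g ∈ I := fun g hg => hIT ▸ Ideal.subset_span hg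
  have hcases : ∀ {a b : Q} {c : k}, binom a b c ∈ Ideal.span (T ∪ {mono k n}) →
      (IsNil (inducedCon I) a ∧ (c = 0 ∨ IsNil (inducedCon I) b)) ∨
        (c ≠ 0 ∧ binom a b c ∈ I) := by
    intro a b c h
    refine binom_mem_span_cases (fun a b c => c ≠ 0 ∧ binom a b c ∈ I)
      {x | IsNil (inducedCon I) x} (fun a => ⟨one_ne_zero, binom_self_one_mem I a⟩)
      (fun a b c h => ⟨inv_ne_zero h.1, binom_inv_mem h.1 h.2⟩)
      (fun a b d c c' h h' => ⟨mul_ne_zero h.1 h'.1, binom_mul_mem h.2 h'.2⟩)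
      (fun a c ha h => ?_) (fun a b c h => h.1) (fun a b c h ha => ha.of_rel ⟨c, h⟩) ?_ h
    · by_contra hc
      exact ha (isNil_of_mono_mem (mono_mem_of_binom_mem h.2 (binom_self_one_mem I a) hc).1)
    · rintro g (hg | rfl)
      · obtain ⟨a, b, c, rfl⟩ := hT g hg
        refine ⟨a, b, c, rfl, fun q => ?_⟩
        have h1 : binom (q + a) (q + b) c ∈ I := by
          rw [← mono_mul_binom]; exact I.mul_mem_left _ (hTI _ hg)
        by_cases hc : c = 0
        · subst hc
          rw [binom_zero_right] at h1
          exact Or.inl ⟨isNil_of_mono_mem h1, Or.inl rfl⟩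
        · exact Or.inr ⟨hc, h1⟩
      · exact ⟨n, n, 0, (binom_zero_right n n).symm, fun q => Or.inl ⟨hn.add_left q, Or.inl rfl⟩⟩
  have hJ : Ideal.span (T ∪ {mono k n}) = I := by
    refine hI.maximal _ ⟨_, ?_, rfl⟩ ?_ hle ?_
    · rintro g (hg | rfl)
      · exact hT g hg
      · exact ⟨n, n, 0, (binom_zero_right n n).symm⟩
    · intro htop
      -- With coefficient 0 this binomial is the unit `t ^ 0`.
      have h1 : binom (0 : Q) 0 (0 : k) ∈ Ideal.span (T ∪ {mono k n}) := htop ▸ trivial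
      rcases hcases h1 with h | h
      · exact h0 h.1
      · exact h.1 rfl
    · ext a b
      constructor
      · rintro ⟨c, hc, h⟩
        rcases hcases h with h | h
        · exact h.1.rel (h.2.resolve_left hc)
        · exact ⟨c, h⟩
      · rintro ⟨c, hc, h⟩
        exact ⟨c, hc, hle h⟩
  rw [← hJ]
  exact Ideal.subset_span (Or.inr rfl)

theorem le_collapse : I ≤ collapse P I w := le_sup_left

/-- Cancelling `f` in the congruence may change the scalar, but two different scalars force both
monomials to be nil, hence in `I`. -/
theorem binom_mem_of_mono_mul_mem (hnil : ∀ n, IsNil (inducedCon I) n → mono k n ∈ I) {f a b : Q}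
    {c : k} (hc : c ≠ 0) (hf : IsCancellative (inducedCon I) f)
    (h : binom (a + f) (b + f) c ∈ I) : binom a b c ∈ I := by
  obtain ⟨d, hd, h1⟩ := hf a b ⟨c, hc, h⟩
  by_cases hcd : c = d
  · rwa [hcd]
  have h2 : binom (a + f) (b + f) d ∈ I := by
    rw [add_comm a, add_comm b, ← mono_mul_binom]; exact I.mul_mem_left _ h1
  obtain ⟨h3, h4⟩ := mono_mem_of_binom_mem h h2 hcd
  exact binom_mem_of_mono_mem c (hnil _ (hf.isNil (isNil_of_mono_mem h3)))
    (hnil _ (hf.isNil (isNil_of_mono_mem h4)))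

theorem collapse_eq_span {T : Set (AddMonoidAlgebra k Q)} (hT : I = Ideal.span T) :
    collapse P I w = Ideal.span (T ∪ {g | ∃ (a b : Q) (c : k), g = binom a b c ∧
      ¬ LocGreenLE P (inducedCon I) w a ∧ ¬ LocGreenLE P (inducedCon I) w b ∧
      ∀ p ∈ P, mono k p * g ∈ I}) := by
  rw [Ideal.span_union, ← hT, collapse]

theorem isBinomialIdeal_collapse (hI : IsBinomialIdeal I) :
    IsBinomialIdeal (collapse P I w) := by
  obtain ⟨T, hT, hIT⟩ := hI
  refine ⟨_, ?_, collapse_eq_span hIT⟩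
  rintro g (hg | ⟨a, b, c, h, -⟩)
  · exact hT g hg
  · exact ⟨a, b, c, h⟩

/-- No monomial outside of the localized ideal of `w` is annihilated by `P`. -/
theorem mono_notMem_annihilated (hP : IsMonoidPrime P) (hI : IsCoprincipalCon P (inducedCon I))
    (hw : IsCogenerator P (inducedCon I) w) {n : Q} (hn : IsNil (inducedCon I) n) {a : Q}
    (ha : ¬ LocGreenLE P (inducedCon I) w a) : mono k a ∉ annihilated P I := by
  intro h
  obtain ⟨p, hp, h1⟩ := hI.exists_not_isNil_add hP hn hw ha
  exact h1 (isNil_of_mono_mem (by rw [add_comm, mono_add]; exact h p hp))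

/-- The binomials of the collapse are those of `I` and the generators added to it. -/
theorem binom_mem_collapse (hP : IsMonoidPrime P) (hI : IsBinomialIdeal I)
    (hr : IsCoprincipalCon P (inducedCon I)) (hw : IsCogenerator P (inducedCon I) w)
    (hnil : ∀ n, IsNil (inducedCon I) n → mono k n ∈ I) {n : Q} (hn : IsNil (inducedCon I) n)
    {a b : Q} {c : k} (h : binom a b c ∈ collapse P I w) :
    binom a b c ∈ I ∨ (c ≠ 0 ∧ ¬ LocGreenLE P (inducedCon I) w a ∧
      ¬ LocGreenLE P (inducedCon I) w b ∧ binom a b c ∈ annihilated P I) := by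
  obtain ⟨T, hT, hIT⟩ := hI
  have hTI : ∀ g ∈ T, g ∈ I := fun g hg => hIT ▸ Ideal.subset_span hg
  rw [collapse_eq_span hIT] at h
  set L := LocGreenLE P (inducedCon I) w with hL
  have hsat : ∀ {a b : Q} {c : k}, c ≠ 0 → binom a b c ∈ I → (L a ↔ L b) := fun {a b c} hc h =>
    ⟨fun h1 => h1.of_rel ⟨c, hc, h⟩, fun h1 => h1.of_rel ((inducedCon I).symm ⟨c, hc, h⟩)⟩
  have hmain := binom_mem_span_cases
    (fun a b c => c ≠ 0 ∧ (binom a b c ∈ I ∨ (¬ L a ∧ ¬ L b ∧ binom a b c ∈ annihilated P I)))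
    {x | IsNil (inducedCon I) x} (fun a => ⟨one_ne_zero, Or.inl (binom_self_one_mem I a)⟩)
    (fun a b c h => ⟨inv_ne_zero h.1, h.2.imp (binom_inv_mem h.1)
      fun h' => ⟨h'.2.1, h'.1, binom_inv_mem h.1 h'.2.2⟩⟩)
    ?_ ?_ (fun a b c h => h.1) ?_ ?_ h
  · rcases hmain with ⟨h1, h2⟩ | h1
    · refine Or.inl ?_
      rcases h2 with h2 | h2
      · rw [h2, binom_zero_right]; exact hnil _ h1
      · exact binom_mem_of_mono_mem c (hnil _ h1) (hnil _ h2)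
    · exact h1.2.imp id fun h2 => ⟨h1.1, h2⟩
  · rintro a b d c c' ⟨hc, h⟩ ⟨hc', h'⟩
    refine ⟨mul_ne_zero hc hc', ?_⟩
    rcases h with h | ⟨h1, h2, h3⟩ <;> rcases h' with h' | ⟨h1', h2', h3'⟩
    · exact Or.inl (binom_mul_mem h h')
    · exact Or.inr ⟨fun h4 => h1' ((hsat hc h).1 h4), h2', binom_mul_mem (le_annihilated h) h3'⟩
    · exact Or.inr ⟨h1, fun h4 => h2 ((hsat hc' h').2 h4), binom_mul_mem h3 (le_annihilated h')⟩
    · exact Or.inr ⟨h1, h2', binom_mul_mem h3 h3'⟩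
  · rintro a c ha ⟨-, h⟩
    by_contra hc
    rcases h with h | ⟨h1, -, h3⟩
    · exact ha (isNil_of_mono_mem (mono_mem_of_binom_mem h (binom_self_one_mem I a) hc).1)
    · exact mono_notMem_annihilated hP hr hw hn h1
        (mono_mem_of_binom_mem h3 (binom_self_one_mem _ a) hc).1
  · rintro a b c ⟨hc, h⟩ ha
    rcases h with h | ⟨h1, -⟩
    · exact IsNil.of_rel ha ⟨c, hc, h⟩
    · exact absurd (IsNil.locGreenLE hP ha w) h1
  · rintro g (hg | ⟨a, b, c, rfl, ha, hb, h⟩)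
    · obtain ⟨a, b, c, rfl⟩ := hT g hg
      refine ⟨a, b, c, rfl, fun q => ?_⟩
      have h1 : binom (q + a) (q + b) c ∈ I := by
        rw [← mono_mul_binom]; exact I.mul_mem_left _ (hTI _ hg)
      by_cases hc : c = 0
      · subst hc
        rw [binom_zero_right] at h1
        exact Or.inl ⟨isNil_of_mono_mem h1, Or.inl rfl⟩
      · exact Or.inr ⟨hc, Or.inl h1⟩
    · refine ⟨a, b, c, rfl, fun q => Or.inr ⟨?_, ?_⟩⟩
      · rintro rfl
        rw [binom_zero_right] at h
        exact mono_notMem_annihilated hP hr hw hn ha h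
      -- Translation by `q ∈ P` moves an added generator into `I`; translation by `q ∉ P` yields
      -- another added generator.
      · by_cases hq : q ∈ P
        · exact Or.inl (mono_mul_binom q a b c ▸ h q hq)
        · refine Or.inr ⟨fun h1 => ha ?_, fun h1 => hb ?_, ?_⟩
          · rw [add_comm] at h1; exact LocGreenLE.of_add hP hq h1
          · rw [add_comm] at h1; exact LocGreenLE.of_add hP hq h1
          · rw [← mono_mul_binom]
            exact Ideal.mul_mem_left _ _ h

/-- When everything is inverted, `w` generates the whole localized quotient, so no generator is
added. -/
theorem collapse_eq_of_isEmpty (I : Ideal (AddMonoidAlgebra k Q)) (w : Q) :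
    collapse ∅ I w = I := by
  refine sup_eq_left.2 (Ideal.span_le.2 ?_)
  rintro g ⟨a, b, c, -, ha, -⟩
  exact absurd ⟨w, Set.notMem_empty w, a, by rw [add_comm]; exact (inducedCon I).refl _⟩ ha

/-- Coarsening a congruence outside of a localized principal ideal leaves the nil class alone. -/
theorem isNil_iff_of_coarser (hP : IsMonoidPrime P) {r s : AddCon Q} (hrs : r ≤ s) {n : Q}
    (hn : IsNil r n)
    (hs : ∀ a b, s a b → r a b ∨ (¬ LocGreenLE P r w a ∧ ¬ LocGreenLE P r w b))
    {x : Q} : IsNil s x ↔ IsNil r x := by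
  refine ⟨fun h => ?_, fun h q => hrs (h q)⟩
  rcases hs _ _ (h.rel (fun q => hrs (hn q))) with h1 | h1
  · exact hn.of_rel (r.symm h1)
  · exact absurd (hn.locGreenLE hP w) h1.2

end Ideals

end Binoccular

/-! ### Transfer of coprincipality to the collapse -/

open Binoccular in
theorem propositionp {k : Type*} [Field k] {Q : Type*} [AddCommMonoid Q]
    [WellFoundedGT (AddCon Q)] (P : Set Q) (hP : Binoccular.IsMonoidPrime P)
    (I : Ideal (AddMonoidAlgebra k Q)) (hI : Binoccular.IsCoprincipalIdeal P I)
    (w : Q) (hw : Binoccular.IsCogenerator P (Binoccular.inducedCon I) w) :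
    (Binoccular.IsCoprincipalIdeal P (Binoccular.collapse P I w) ∧
      Binoccular.IsCogenerator P (Binoccular.inducedCon (Binoccular.collapse P I w)) w) ∧
    ∀ (a b : Q) (c : k), Binoccular.binom a b c ∈ Binoccular.collapse P I w →
      Binoccular.binom a b c ∉ I →
      Binoccular.IsKeyWitnessPair P (Binoccular.inducedCon I) a b := by
  rcases P.eq_empty_or_nonempty with rfl | ⟨p₀, hp₀⟩
  · rw [collapse_eq_of_isEmpty]
    exact ⟨⟨hI, hw⟩, fun a b c h h' => absurd h h'⟩
  have hr := hI.con
  obtain ⟨m, hn⟩ := hr.1.1.1 p₀ hp₀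
  set n := m • p₀
  have hwn := hw.not_isNil hp₀
  have hnil : ∀ n, IsNil (inducedCon I) n → mono k n ∈ I := fun _ =>
    hI.mono_mem fun h0 => hwn (by simpa using h0.add w)
  have hmem : ∀ {a b : Q} {c : k}, binom a b c ∈ collapse P I w → binom a b c ∈ I ∨
      (c ≠ 0 ∧ ¬ LocGreenLE P (inducedCon I) w a ∧ ¬ LocGreenLE P (inducedCon I) w b ∧
        binom a b c ∈ annihilated P I) :=
    fun h => binom_mem_collapse hP hI.binomial hr hw hnil hn h
  have hle : inducedCon I ≤ inducedCon (collapse P I w) := fun a b ⟨c, hc, h⟩ =>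
    ⟨c, hc, le_collapse h⟩
  have hrel : ∀ {a b : Q} {c : k}, c ≠ 0 → binom a b c ∈ annihilated P I → ∀ p ∈ P,
      inducedCon I (a + p) (b + p) := fun {a b c} hc h p hp =>
    ⟨c, hc, by rw [add_comm a, add_comm b, ← mono_mul_binom]; exact h p hp⟩
  have hcases : ∀ a b, inducedCon (collapse P I w) a b → inducedCon I a b ∨
      (¬ LocGreenLE P (inducedCon I) w a ∧ ¬ LocGreenLE P (inducedCon I) w b ∧
        ∃ c : k, c ≠ 0 ∧ binom a b c ∈ annihilated P I) := by
    rintro a b ⟨c, hc, h⟩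
    rcases hmem h with h | ⟨-, h1, h2, h3⟩
    · exact Or.inl ⟨c, hc, h⟩
    · exact Or.inr ⟨h1, h2, c, hc, h3⟩
  have hniliff : ∀ x, IsNil (inducedCon (collapse P I w)) x ↔ IsNil (inducedCon I) x := fun x =>
    isNil_iff_of_coarser hP hle hn fun a b h => (hcases a b h).imp id fun h => ⟨h.1, h.2.1⟩
  have hn1 := (hniliff n).2 hn
  refine ⟨⟨⟨isBinomialIdeal_collapse hI.binomial, ?_, ⟨⟨⟨?_, ?_⟩, ?_⟩, ?_⟩, ?_⟩, ?_⟩, ?_⟩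
  · intro htop
    have h1 : binom (0 : Q) 0 (0 : k) ∈ collapse P I w := htop ▸ trivial
    rcases hmem h1 with h | h
    · rw [binom_zero_right] at h
      exact hI.ne_top (eq_top_of_mono_zero_mem h)
    · exact h.1 rfl
  · exact fun p hp => (hr.1.1.1 p hp).imp fun m h => (hniliff _).2 h
  · intro f hf a b h
    have hfc := hr.1.1.2 f hf
    rcases hcases _ _ h with h | ⟨h1, h2, c, hc, h3⟩
    · exact hle (hfc _ _ h)
    · refine ⟨c, hc, Ideal.mem_sup_right (Ideal.subset_span ⟨a, b, c, rfl,
        fun h4 => h1 (h4.add_right f), fun h4 => h2 (h4.add_right f), fun p hp => ?_⟩)⟩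
      have h5 := h3 p hp
      rw [mono_mul_binom, ← add_assoc, ← add_assoc] at h5
      rw [mono_mul_binom]
      exact binom_mem_of_mono_mul_mem hnil hc hfc h5
  -- A cancellative `a ∈ P` has a nil multiple `m • a`; cancelling `a` repeatedly from `w + m • a`
  -- would make `w` nil.
  · have hnotMem : ∀ a, IsCancellative (inducedCon (collapse P I w)) a → a ∉ P := by
      intro a ha haP
      obtain ⟨m, hm⟩ := hr.1.1.1 a haP
      have H : ∀ j : ℕ, IsNil (inducedCon (collapse P I w)) (w + j • a) → False := by
        intro j
        induction j with
        | zero => exact fun h => hwn ((hniliff w).1 (by simpa using h))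
        | succ j ih =>
          intro h
          rw [succ_nsmul, ← add_assoc] at h
          exact ih (ha.isNil h)
      exact H m ((hniliff _).2 (hm.add_left w))
    intro q a b ha hb h hq
    have ha' := hr.1.1.2 a (hnotMem a ha)
    have hb' := hr.1.1.2 b (hnotMem b hb)
    rcases hcases _ _ h with h | ⟨h1, h2, c, hc, h3⟩
    · exact hle (hr.1.2 q a b ha' hb' h fun h0 => hq ((hniliff _).2 h0))
    -- Adding `p` turns the new relation into an old one, and this `p` keeps the sum non-nil.
    · obtain ⟨p, hp, hnp⟩ := hr.exists_not_isNil_add hP hn hw h1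
      refine hle (hr.1.2 (q + p) a b ha' hb' ?_ ?_)
      · rw [add_right_comm q p a, add_right_comm q p b]
        exact hrel hc h3 p hp
      · rwa [add_right_comm q p a]
  · have hcog : ∀ v, IsCogenerator P (inducedCon (collapse P I w)) v →
        IsCogenerator P (inducedCon I) v := fun v hv =>
      isCogenerator_of_not_isNil hn (fun h => hv.not_isNil hp₀ ((hniliff v).2 h))
        fun p hp => (hniliff _).1 (hv.2 p hp)
    intro u v hu hv
    obtain ⟨f, hf, c, hc⟩ := hr.2 u v (hcog u hu) (hcog v hv)
    exact ⟨f, hf, c, hle hc⟩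
  · intro J hJ hJtop hIJ hcon
    have hnilJ : ∀ x, mono k x ∈ J → mono k x ∈ collapse P I w := fun x hx => by
      have h1 := isNil_of_mono_mem hx
      rw [hcon] at h1
      exact le_collapse (hnil x ((hniliff x).1 h1))
    obtain ⟨T, hT, rfl⟩ := hJ
    refine le_antisymm (Ideal.span_le.2 fun g hg => ?_) hIJ
    have hgJ : g ∈ Ideal.span T := Ideal.subset_span hg
    obtain ⟨a, b, c, rfl⟩ := hT g hg
    by_cases hc : c = 0
    · subst hc
      rw [binom_zero_right] at hgJ ⊢
      exact hnilJ a hgJ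
    · have h1 : inducedCon (Ideal.span T) a b := ⟨c, hc, hgJ⟩
      rw [hcon] at h1
      obtain ⟨d, hd, h1⟩ := h1
      -- Differing scalars would put both monomials into `J`; their exponents are nil, so these
      -- monomials already lie in `I`.
      by_cases hcd : c = d
      · rw [hcd]; exact h1
      · obtain ⟨h2, h3⟩ := mono_mem_of_binom_mem hgJ (hIJ h1) hcd
        exact binom_mem_of_mono_mem c (hnilJ a h2) (hnilJ b h3)
  · exact isCogenerator_of_not_isNil hn1 (fun h => hwn ((hniliff w).1 h))
      fun p hp => (hniliff _).2 (hw.2 p hp)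
  · intro a b c h hnot
    rcases hmem h with h | ⟨hc, ha, hb, h3⟩
    · exact absurd h hnot
    -- A relation already present in `I` has the same scalar, contradicting `hnot`, or makes `t ^ a`
    -- annihilated by `P`.
    have hab : ¬ inducedCon I a b := by
      rintro ⟨d, hd, h4⟩
      by_cases hcd : c = d
      · exact hnot (hcd ▸ h4)
      · exact mono_notMem_annihilated hP hr hw hn ha
          (mono_mem_of_binom_mem h3 (le_annihilated h4) hcd).1
    have h1 := hr.isKeyAide hP hn hw ha hb hab (hrel hc h3)
    have h2 := hr.isKeyAide hP hn hw hb ha (fun h => hab ((inducedCon I).symm h))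
      fun p hp => (inducedCon I).symm (hrel hc h3 p hp)
    exact ⟨hab, ⟨b, h1⟩, ⟨a, h2⟩, h2, h1⟩
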